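/- Let $M,n,m$ be positive integers, let $A_i\in\mathbb{R}^{n\times n}$ and $B_i\in\mathbb{R}^{n\times m}$ for $i\in\langle M\rangle:=\{1,\dots,M\}$, and consider the discrete-time switched control system $$x(k+1)=A_{\sigma(k)}x(k)+B_{\sigma(k)}u(k),\qquad k\in\mathbb{N}=\{0,1,2,\dots\},$$ with arbitrary switching signal $\sigma:\mathbb{N}\to\langle M\rangle$. A difference inclusion $x(k+1)\in F(x(k))$ with $F:\mathbb{R}^n\rightrightarrows\mathbb{R}^n$ is *uniformly exponentially stable* (UES) if there are $C\ge 0$ and $\gamma\in[0,1)$ such that $|\phi(k)|\le C\gamma^k|\phi(0)|$ for every $k\in\mathbb{N}$ and every $\phi:\mathbb{N}\to\mathbb{R}^n$ with $\phi(k+1)\in F(\phi(k))$ for all $k$; here $|\cdot|$ is the Euclidean norm. The system is *mode-independent feedback stabilizable* (IFS) if there is a map $\Phi:\mathbb{R}^n\to\mathbb{R}^m$ (no regularity is required) for which the inclusion with $F(x)=\{A_ix+B_i\Phi(x) : i\in\langle M\rangle\}$ is UES. It is *mode-dependent feedback stabilizable* (DFS) if there are maps $\Phi_1,\dots,\Phi_M:\mathbb{R}^n\to\mathbb{R}^m$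 for which the inclusion with $F(x)=\{A_ix+B_i\Phi_i(x) : i\in\langle M\rangle\}$ is UES. For $T\in\mathbb{N}$, the *feedback-tree graph of order $T$* has as nodes the strings over $\langle M\rangle$ of length at most $T$, including the empty string $\epsilon$; its labeled edges $(w,v,i)$ are, for every $i\in\langle M\rangle$, the triples $(w,(w,i),i)$ for each string $w$ of length less than $T$ (where $(w,i)$ is $w$ with $i$ appended), and the triples $(w,\epsilon,i)$ for each string $w$ of length $T$. The *mode-independent LMIs of order $T$* are feasible if there are symmetric positive definite matrices $P_w\in\mathbb{R}^{n\times n}$ and matrices $K_w\in\mathbb{R}^{m\times n}$, indexed by the nodes $w$, such that $$\begin{bmatrix} P_w & P_wA_i^\top+K_w^\top B_i^\top\\ A_iP_w+B_iK_w & P_v\end{bmatrix}\succ 0\qquad\text{for every edge }(w,v,i).$$ The *mode-dependent LMIs of order $T$* are feasible if there are symmetric positive definite matrices $P_w\in\mathbb{R}^{n\times n}$ and matrices $K_{w,i}\in\mathbb{R}^{m\times n}$, indexed by the nodes $w$ and by $i\in\langle M\rangle$, such that the same inequalities hold with $K_{w,i}$ in place of $K_w$. **Theorem.** 1. The system is IFS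 if and only if there is a $T\in\mathbb{N}$ for which the mode-independent LMIs of order $T$ are feasible; equivalently, if and only if these LMIs are feasible for all sufficiently large $T$. 2. The system is DFS if and only if there is a $T\in\mathbb{N}$ for which the mode-dependent LMIs of order $T$ are feasible; equivalently, if and only if these LMIs are feasible for all sufficiently large $T$. -/

import Mathlib

namespace FeedbackTree

section Stability

variable {n : ℕ}

/-- `φ` is a global solution of the difference inclusion `x(k+1) ∈ F(x(k))` with `x(0) = x₀`. -/
def IsSolution (F : EuclideanSpace ℝ (Fin n) → Set (EuclideanSpace ℝ (Fin n)))
    (x₀ : EuclideanSpace ℝ (Fin n)) (φ : ℕ → EuclideanSpace ℝ (Fin n)) : Prop :=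
  φ 0 = x₀ ∧ ∀ k : ℕ, φ (k + 1) ∈ F (φ k)

/-- Uniform exponential stability of the difference inclusion `x(k+1) ∈ F(x(k))`. -/
def IsUES (F : EuclideanSpace ℝ (Fin n) → Set (EuclideanSpace ℝ (Fin n))) : Prop :=
  ∃ C γ : ℝ, 0 ≤ C ∧ 0 ≤ γ ∧ γ < 1 ∧
    ∀ (x₀ : EuclideanSpace ℝ (Fin n)) (φ : ℕ → EuclideanSpace ℝ (Fin n)),
      IsSolution F x₀ φ → ∀ k : ℕ, ‖φ k‖ ≤ C * γ ^ k * ‖x₀‖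

end Stability

section SwitchedSystem

variable {M n m : ℕ}

/-- The closed-loop set-valued map `x ↦ {A_i x + B_i Φ(x) | i}` of a mode-independent feedback. -/
def closedLoopInd (A : Fin M → Matrix (Fin n) (Fin n) ℝ) (B : Fin M → Matrix (Fin n) (Fin m) ℝ)
    (Φ : EuclideanSpace ℝ (Fin n) → EuclideanSpace ℝ (Fin m)) :
    EuclideanSpace ℝ (Fin n) → Set (EuclideanSpace ℝ (Fin n)) :=
  fun x => {y | ∃ i : Fin M,
    y = Matrix.toEuclideanLin (A i) x + Matrix.toEuclideanLin (B i) (Φ x)}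

/-- The closed-loop set-valued map `x ↦ {A_i x + B_i Φ_i(x) | i}` of a mode-dependent feedback. -/
def closedLoopDep (A : Fin M → Matrix (Fin n) (Fin n) ℝ) (B : Fin M → Matrix (Fin n) (Fin m) ℝ)
    (Φ : Fin M → EuclideanSpace ℝ (Fin n) → EuclideanSpace ℝ (Fin m)) :
    EuclideanSpace ℝ (Fin n) → Set (EuclideanSpace ℝ (Fin n)) :=
  fun x => {y | ∃ i : Fin M,
    y = Matrix.toEuclideanLin (A i) x + Matrix.toEuclideanLin (B i) (Φ i x)}

/-- Mode-independent feedback stabilizability: the feedback is an arbitrary map. -/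
def IsIFS (A : Fin M → Matrix (Fin n) (Fin n) ℝ) (B : Fin M → Matrix (Fin n) (Fin m) ℝ) : Prop :=
  ∃ Φ : EuclideanSpace ℝ (Fin n) → EuclideanSpace ℝ (Fin m), IsUES (closedLoopInd A B Φ)

/-- Mode-dependent feedback stabilizability: one arbitrary feedback map for each mode. -/
def IsDFS (A : Fin M → Matrix (Fin n) (Fin n) ℝ) (B : Fin M → Matrix (Fin n) (Fin m) ℝ) : Prop :=
  ∃ Φ : Fin M → EuclideanSpace ℝ (Fin n) → EuclideanSpace ℝ (Fin m),
    IsUES (closedLoopDep A B Φ)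

end SwitchedSystem

section Graph

/-- The nodes of the feedback-tree graph of order `T` on `M` symbols: the strings of length at
most `T`, including the empty one. -/
def Node (M T : ℕ) : Type := {w : List (Fin M) // w.length ≤ T}

/-- The root: the empty string. -/
def root (M T : ℕ) : Node M T := ⟨[], Nat.zero_le T⟩

/-- The child `(w, i)` of a node `w` of length less than `T`. -/
def child {M T : ℕ} (w : Node M T) (i : Fin M) (h : w.1.length < T) : Node M T :=
  ⟨w.1 ++ [i], by simpa using h⟩

/-- The labeled edges of the feedback-tree graph: `Edge w v i` means that there is an edge
from `w` to `v` with label `i`. -/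
inductive Edge {M T : ℕ} : Node M T → Node M T → Fin M → Prop
  | grow (w : Node M T) (i : Fin M) (h : w.1.length < T) : Edge w (child w i h) i
  | reset (w : Node M T) (i : Fin M) (h : w.1.length = T) : Edge w (root M T) i

end Graph

section LMI

variable {M n m : ℕ}

/-- The symmetric block matrix `[P, P Aᵀ + Kᵀ Bᵀ; ⋆, Q]`. -/
def lmiBlock (A : Matrix (Fin n) (Fin n) ℝ) (B : Matrix (Fin n) (Fin m) ℝ)
    (P Q : Matrix (Fin n) (Fin n) ℝ) (K : Matrix (Fin m) (Fin n) ℝ) :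
    Matrix (Fin n ⊕ Fin n) (Fin n ⊕ Fin n) ℝ :=
  Matrix.fromBlocks P (P * A.transpose + K.transpose * B.transpose)
    (P * A.transpose + K.transpose * B.transpose).transpose Q

/-- Feasibility of the mode-independent LMIs on the feedback-tree graph of order `T`. -/
def FeasibleInd (A : Fin M → Matrix (Fin n) (Fin n) ℝ) (B : Fin M → Matrix (Fin n) (Fin m) ℝ)
    (T : ℕ) : Prop :=
  ∃ (P : Node M T → Matrix (Fin n) (Fin n) ℝ) (K : Node M T → Matrix (Fin m) (Fin n) ℝ),
    (∀ w, (P w).PosDef) ∧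
    ∀ (w v : Node M T) (i : Fin M), Edge w v i → (lmiBlock (A i) (B i) (P w) (P v) (K w)).PosDef

/-- Feasibility of the mode-dependent LMIs on the feedback-tree graph of order `T`. -/
def FeasibleDep (A : Fin M → Matrix (Fin n) (Fin n) ℝ) (B : Fin M → Matrix (Fin n) (Fin m) ℝ)
    (T : ℕ) : Prop :=
  ∃ (P : Node M T → Matrix (Fin n) (Fin n) ℝ)
    (K : Node M T → Fin M → Matrix (Fin m) (Fin n) ℝ),
    (∀ w, (P w).PosDef) ∧
    ∀ (w v : Node M T) (i : Fin M), Edge w v i →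
      (lmiBlock (A i) (B i) (P w) (P v) (K w i)).PosDef

end LMI

end FeedbackTree

/-! Sufficiency: the minimum over nodes of the forms `xᵀ P_w⁻¹ x` is a Lyapunov function. At `x`,
use the gain `K_w P_w⁻¹` of a minimizing `w`; the LMI on the edge taken bounds the next value of the
minimum (`posDef_decrease_of_lmiBlock`, `exists_isUES_of_lmi`). Necessity: run the given feedback,
however irregular, only from the basis vectors. Let `X_w` collect the states after string `w`, `U_w`
the feedback values there, and put `P_w = X_w X_wᵀ + ε a^|w| I`, `K_w = U_w X_wᵀ`. The data satisfy
`X_(w,i) = A_i X_w + B_i U_w`, so each block is a Gram matrix plus a remainder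
(`posDef_lmiBlock_of_data`). Growth of the regularization pays for the remainder inside the tree; at
a reset, stability makes the states small against `P_ε ≻ I` (`exists_lmi_of_isUES`). -/

namespace FeedbackTree

open Matrix Filter Topology

/-! ### Bounds on quadratic forms -/

section Quadratic

variable {ι κ : Type*} [Fintype ι] [Fintype κ]

/-- The quadratic form `xᵀ S x` on Euclidean space. -/
def quad (S : Matrix ι ι ℝ) (x : EuclideanSpace ℝ ι) : ℝ := x.ofLp ⬝ᵥ (S *ᵥ x.ofLp)

theorem continuous_quad (S : Matrix ι ι ℝ) : Continuous (quad S) := by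
  unfold quad
  fun_prop

theorem quad_smul (S : Matrix ι ι ℝ) (c : ℝ) (x : EuclideanSpace ℝ ι) :
    quad S (c • x) = c ^ 2 * quad S x := by
  simp [quad, mulVec_smul, sq, mul_assoc]

theorem quad_pos {S : Matrix ι ι ℝ} (hS : S.PosDef) {x : EuclideanSpace ℝ ι} (hx : x ≠ 0) :
    0 < quad S x := by
  have h : x.ofLp ≠ 0 := fun h => hx (by ext i; simp [h])
  simpa [quad] using hS.dotProduct_mulVec_pos h

theorem quad_eq_norm_sq_mul (S : Matrix ι ι ℝ) (x : EuclideanSpace ℝ ι) :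
    ∃ u : EuclideanSpace ℝ ι, (x ≠ 0 → u ∈ Metric.sphere 0 1) ∧
      quad S x = ‖x‖ ^ 2 * quad S u := by
  refine ⟨‖x‖⁻¹ • x, fun hx => ?_, ?_⟩
  · have : ‖x‖ ≠ 0 := norm_ne_zero_iff.2 hx
    simp [norm_smul, this]
  · by_cases hx : x = 0
    · subst hx; simp [quad]
    · have : ‖x‖ ≠ 0 := norm_ne_zero_iff.2 hx
      rw [quad_smul]; field_simp

theorem exists_quad_le (S : Matrix ι ι ℝ) :
    ∃ c : ℝ, ∀ x : EuclideanSpace ℝ ι, quad S x ≤ c * ‖x‖ ^ 2 := by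
  obtain ⟨c, hc⟩ := (isCompact_sphere (0 : EuclideanSpace ℝ ι) 1).exists_bound_of_continuousOn
    (continuous_quad S).continuousOn
  refine ⟨c, fun x => ?_⟩
  by_cases hx : x = 0
  · subst hx; simp [quad]
  obtain ⟨u, hu, h⟩ := quad_eq_norm_sq_mul S x
  rw [h, mul_comm]
  exact mul_le_mul_of_nonneg_right ((le_abs_self _).trans (hc u (hu hx))) (by positivity)

theorem exists_le_quad {S : Matrix ι ι ℝ} (hS : S.PosDef) :
    ∃ δ > 0, ∀ x : EuclideanSpace ℝ ι, δ * ‖x‖ ^ 2 ≤ quad S x := by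
  have hpos : ∀ u ∈ Metric.sphere (0 : EuclideanSpace ℝ ι) 1, 0 < quad S u := fun u hu =>
    quad_pos hS (fun h => by simp [h] at hu)
  obtain ⟨c, hc⟩ := (isCompact_sphere (0 : EuclideanSpace ℝ ι) 1).exists_bound_of_continuousOn
    ((continuous_quad S).continuousOn.inv₀ fun u hu => (hpos u hu).ne')
  -- The maximum keeps the constant positive even if the sphere is empty.
  refine ⟨(max c 1)⁻¹, by positivity, fun x => ?_⟩
  by_cases hx : x = 0
  · subst hx; simp [quad]
  obtain ⟨u, hu, h⟩ := quad_eq_norm_sq_mul S x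
  rw [h, mul_comm]
  have h1 : (quad S u)⁻¹ ≤ max c 1 :=
    ((le_abs_self _).trans (hc u (hu hx))).trans (le_max_left _ _)
  exact mul_le_mul_of_nonneg_left (inv_le_of_inv_le₀ (hpos u (hu hx)) h1) (by positivity)

/-- The filter form lets one constant serve finitely many matrices at once. -/
theorem eventually_quad_le (S : Matrix ι ι ℝ) :
    ∀ᶠ c : ℝ in atTop, ∀ x : EuclideanSpace ℝ ι, quad S x ≤ c * ‖x‖ ^ 2 := by
  obtain ⟨c, hc⟩ := exists_quad_le S
  filter_upwards [eventually_ge_atTop c] with d hd x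
  exact (hc x).trans (by gcongr)

theorem eventually_le_quad {S : Matrix ι ι ℝ} (hS : S.PosDef) :
    ∀ᶠ δ : ℝ in 𝓝[>] 0, ∀ x : EuclideanSpace ℝ ι, δ * ‖x‖ ^ 2 ≤ quad S x := by
  obtain ⟨c, hc, h⟩ := exists_le_quad hS
  filter_upwards [nhdsWithin_le_nhds (eventually_le_nhds hc)] with d hd x
  exact le_trans (by gcongr) (h x)

/-- `c I - Y Yᵀ` is positive definite when `c` exceeds the squared Frobenius norm of `Y`. -/
theorem posDef_smul_one_sub_mul_transpose [DecidableEq ι] (Y : Matrix ι κ ℝ) {c : ℝ}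
    (hc : ∑ j, ∑ i, Y i j ^ 2 < c) : (c • (1 : Matrix ι ι ℝ) - Y * Yᵀ).PosDef := by
  refine .of_dotProduct_mulVec_pos ?_ fun q hq => ?_
  · simp [IsHermitian, conjTranspose_eq_transpose_of_trivial]
  · have hq0 : 0 < q ⬝ᵥ q := by
      have := dotProduct_star_self_pos_iff.2 hq
      simpa using this
    have hY : q ⬝ᵥ ((Y * Yᵀ) *ᵥ q) ≤ (∑ j, ∑ i, Y i j ^ 2) * (q ⬝ᵥ q) := by
      rw [← mulVec_mulVec, dotProduct_mulVec, ← mulVec_transpose, Finset.sum_mul]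
      refine Finset.sum_le_sum fun j _ => ?_
      -- Cauchy–Schwarz on each column of `Y`.
      have := Finset.sum_mul_sq_le_sq_mul_sq Finset.univ (fun i => Y i j) q
      simpa [mulVec, dotProduct, sq] using this
    have : (∑ j, ∑ i, Y i j ^ 2) * (q ⬝ᵥ q) < c * (q ⬝ᵥ q) := by gcongr
    simp only [star_trivial, sub_mulVec, smul_mulVec, one_mulVec, dotProduct_sub,
      dotProduct_smul, smul_eq_mul]
    linarith

end Quadratic

/-! ### Positivity of the LMI block -/

section Block

variable {n m : ℕ}

theorem lmiBlock_quadraticForm (A : Matrix (Fin n) (Fin n) ℝ) (B : Matrix (Fin n) (Fin m) ℝ)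
    (P Q : Matrix (Fin n) (Fin n) ℝ) (K : Matrix (Fin m) (Fin n) ℝ) (p q : Fin n → ℝ)
    (hP : Pᵀ = P) :
    Sum.elim p q ⬝ᵥ (lmiBlock A B P Q K *ᵥ Sum.elim p q) =
      p ⬝ᵥ (P *ᵥ p) + 2 * (q ⬝ᵥ ((A * P + B * K) *ᵥ p)) + q ⬝ᵥ (Q *ᵥ q) := by
  have h : P * Aᵀ + Kᵀ * Bᵀ = (A * P + B * K)ᵀ := by simp [hP]
  rw [lmiBlock, h, fromBlocks_mulVec, sumElim_dotProduct_sumElim]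
  simp only [Sum.elim_comp_inl, Sum.elim_comp_inr, transpose_transpose, dotProduct_add]
  rw [dotProduct_transpose_mulVec]
  ring

theorem isHermitian_lmiBlock (A : Matrix (Fin n) (Fin n) ℝ) (B : Matrix (Fin n) (Fin m) ℝ)
    {P Q : Matrix (Fin n) (Fin n) ℝ} (K : Matrix (Fin m) (Fin n) ℝ)
    (hP : Pᵀ = P) (hQ : Qᵀ = Q) : (lmiBlock A B P Q K).IsHermitian := by
  rw [IsHermitian, conjTranspose_eq_transpose_of_trivial, lmiBlock, fromBlocks_transpose, hP, hQ,
    transpose_transpose]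

/-- The block matrix generated by sampled data `Y = A X + B U`, regularized by `ε I`. -/
theorem posDef_lmiBlock_of_data (A : Matrix (Fin n) (Fin n) ℝ) (B : Matrix (Fin n) (Fin m) ℝ)
    (X Q : Matrix (Fin n) (Fin n) ℝ) (U : Matrix (Fin m) (Fin n) ℝ) {ε : ℝ} (hε : 0 < ε)
    (hQ : Qᵀ = Q)
    (hR : (Q - (A * X + B * U) * (A * X + B * U)ᵀ - ε • (A * Aᵀ)).PosDef) :
    (lmiBlock A B (X * Xᵀ + ε • 1) Q (U * Xᵀ)).PosDef := by
  have hP : (X * Xᵀ + ε • (1 : Matrix (Fin n) (Fin n) ℝ))ᵀ = X * Xᵀ + ε • 1 := by simp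
  refine .of_dotProduct_mulVec_pos (isHermitian_lmiBlock A B _ hP hQ) fun x hx => ?_
  obtain ⟨p, q, rfl⟩ : ∃ p q, x = Sum.elim p q := ⟨_, _, (Sum.elim_comp_inl_inr x).symm⟩
  rw [star_trivial, lmiBlock_quadraticForm A B _ _ _ p q hP]
  set Y := A * X + B * U with hY
  -- Complete two squares: one from the data, one from the regularization.
  have key : p ⬝ᵥ ((X * Xᵀ + ε • (1 : Matrix (Fin n) (Fin n) ℝ)) *ᵥ p) +
      2 * (q ⬝ᵥ ((A * (X * Xᵀ + ε • 1) + B * (U * Xᵀ)) *ᵥ p)) + q ⬝ᵥ (Q *ᵥ q) =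
      (Xᵀ *ᵥ p + Yᵀ *ᵥ q) ⬝ᵥ (Xᵀ *ᵥ p + Yᵀ *ᵥ q) +
      ε * ((p + Aᵀ *ᵥ q) ⬝ᵥ (p + Aᵀ *ᵥ q)) +
      q ⬝ᵥ ((Q - Y * Yᵀ - ε • (A * Aᵀ)) *ᵥ q) := by
    have e1 : A * (X * Xᵀ + ε • 1) + B * (U * Xᵀ) = Y * Xᵀ + ε • A := by
      rw [hY]; simp [Matrix.mul_add, Matrix.add_mul, Matrix.mul_assoc]; abel
    have f : ∀ (N L : Matrix (Fin n) (Fin n) ℝ) (a b : Fin n → ℝ),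
        (Nᵀ *ᵥ a) ⬝ᵥ (Lᵀ *ᵥ b) = a ⬝ᵥ ((N * Lᵀ) *ᵥ b) := fun N L a b => by
      rw [← mulVec_mulVec, dotProduct_mulVec a, mulVec_transpose N]
    rw [e1]
    have f1 := f Y X q p
    have f2 := f X X p p
    have f3 := f Y Y q q
    have f4 := f A A q q
    have f5 := f A 1 q p
    simp only [transpose_one, one_mulVec, Matrix.mul_one] at f5
    simp only [add_mulVec, sub_mulVec, smul_mulVec, one_mulVec, dotProduct_add, add_dotProduct,
      dotProduct_sub, dotProduct_smul, smul_eq_mul, ← f2, ← f1, ← f3, ← f4, ← f5,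
      dotProduct_comm p (Aᵀ *ᵥ q), dotProduct_comm (Xᵀ *ᵥ p) (Yᵀ *ᵥ q)]
    ring
  rw [key]
  have nn : ∀ v : Fin n → ℝ, 0 ≤ v ⬝ᵥ v := fun v => by
    simpa using dotProduct_star_self_nonneg v
  have h1 := nn (Xᵀ *ᵥ p + Yᵀ *ᵥ q)
  by_cases hq : q = 0
  · have hp : p ≠ 0 := by
      rintro rfl
      exact hx (by subst hq; ext (i | i) <;> rfl)
    have hpp : 0 < p ⬝ᵥ p := by
      have := dotProduct_star_self_pos_iff.2 hp
      simpa using this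
    subst hq
    simp only [mulVec_zero, add_zero, zero_dotProduct] at h1 ⊢
    have := mul_pos hε hpp
    linarith
  · have h2 := mul_nonneg hε.le (nn (p + Aᵀ *ᵥ q))
    have h3 := hR.dotProduct_mulVec_pos hq
    rw [star_trivial] at h3
    linarith

/-- Positive definiteness of the block matrix makes `x ↦ xᵀ P⁻¹ x` decrease to `yᵀ Q⁻¹ y` along
`y = (A + B K P⁻¹) x`. -/
theorem posDef_decrease_of_lmiBlock {A : Matrix (Fin n) (Fin n) ℝ} {B : Matrix (Fin n) (Fin m) ℝ}
    {P Q : Matrix (Fin n) (Fin n) ℝ} {K : Matrix (Fin m) (Fin n) ℝ} (hP : P.PosDef)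
    (hQ : Q.PosDef) (h : (lmiBlock A B P Q K).PosDef) :
    (P⁻¹ - (A + B * (K * P⁻¹))ᵀ * Q⁻¹ * (A + B * (K * P⁻¹))).PosDef := by
  have hPt : Pᵀ = P := by simpa using hP.isHermitian.eq
  have hPit : P⁻¹ᵀ = P⁻¹ := by rw [transpose_nonsing_inv, hPt]
  have hQit : Q⁻¹ᵀ = Q⁻¹ := by simpa using hQ.inv.isHermitian.eq
  have hPu : IsUnit P.det := (isUnit_iff_isUnit_det P).1 hP.isUnit
  have hQu : IsUnit Q.det := (isUnit_iff_isUnit_det Q).1 hQ.isUnit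
  have hF : A + B * (K * P⁻¹) = (A * P + B * K) * P⁻¹ := by
    rw [Matrix.add_mul, Matrix.mul_assoc A, mul_nonsing_inv P hPu, Matrix.mul_one,
      Matrix.mul_assoc]
  set F := A + B * (K * P⁻¹) with hFdef
  refine .of_dotProduct_mulVec_pos ?_ fun x hx => ?_
  · rw [IsHermitian, conjTranspose_eq_transpose_of_trivial]
    simp only [transpose_sub, transpose_mul, transpose_transpose, hPit, hQit, Matrix.mul_assoc]
  -- With `p = P⁻¹ x` fixed, this `q` minimizes the block form; the minimum is the Schur complement.
  · have hne : Sum.elim (P⁻¹ *ᵥ x) (-(Q⁻¹ *ᵥ (F *ᵥ x))) ≠ 0 := by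
      intro h0
      have : P⁻¹ *ᵥ x = 0 := by ext i; exact congrFun h0 (Sum.inl i)
      apply hx
      have := congrArg (P *ᵥ ·) this
      simpa [mulVec_mulVec, mul_nonsing_inv P hPu] using this
    have hpos := h.dotProduct_mulVec_pos hne
    rw [star_trivial, lmiBlock_quadraticForm A B _ _ _ _ _ hPt] at hpos
    have e1 : P *ᵥ (P⁻¹ *ᵥ x) = x := by simp [mulVec_mulVec, mul_nonsing_inv P hPu]
    have e2 : (A * P + B * K) *ᵥ (P⁻¹ *ᵥ x) = F *ᵥ x := by rw [mulVec_mulVec, ← hF]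
    have e3 : Q *ᵥ (-(Q⁻¹ *ᵥ (F *ᵥ x))) = -(F *ᵥ x) := by
      simp [mulVec_neg, mulVec_mulVec, ← Matrix.mul_assoc, mul_nonsing_inv Q hQu]
    rw [e1, e2, e3] at hpos
    have e4 : x ⬝ᵥ ((Fᵀ * Q⁻¹ * F) *ᵥ x) = (F *ᵥ x) ⬝ᵥ (Q⁻¹ *ᵥ (F *ᵥ x)) := by
      rw [← mulVec_mulVec, ← mulVec_mulVec, dotProduct_mulVec, vecMul_transpose]
    rw [star_trivial, sub_mulVec, dotProduct_sub, e4]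
    simp only [neg_dotProduct, dotProduct_neg, neg_neg] at hpos
    rw [dotProduct_comm (Q⁻¹ *ᵥ (F *ᵥ x)), dotProduct_comm (P⁻¹ *ᵥ x)] at hpos
    linarith

end Block

/-! ### From LMIs to a stabilizing feedback -/

section Sufficiency

variable {M n m T : ℕ}

instance : Finite (Node M T) := (List.finite_length_le (Fin M) T).to_subtype

instance : Nonempty (Node M T) := ⟨root M T⟩

theorem exists_edge (w : Node M T) (i : Fin M) : ∃ v, Edge w v i := by
  rcases w.2.lt_or_eq with h | h
  · exact ⟨_, .grow w i h⟩
  · exact ⟨_, .reset w i h⟩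

/-- A finite family of quadratic functions, with a mode-dependent linear gain for each member, of
which every one decreases to some other in every mode, yields exponential stability of the feedback
that uses the gain of a minimizing member. -/
theorem exists_isUES_of_lmi {A : Fin M → Matrix (Fin n) (Fin n) ℝ}
    {B : Fin M → Matrix (Fin n) (Fin m) ℝ} {P : Node M T → Matrix (Fin n) (Fin n) ℝ}
    {K : Node M T → Fin M → Matrix (Fin m) (Fin n) ℝ} (hP : ∀ w, (P w).PosDef)
    (hE : ∀ w v i, Edge w v i → (lmiBlock (A i) (B i) (P w) (P v) (K w i)).PosDef) :
    ∃ s : EuclideanSpace ℝ (Fin n) → Node M T,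
      IsUES (closedLoopDep A B fun i x => toEuclideanLin (K (s x) i * (P (s x))⁻¹) x) := by
  have hmin : ∀ x : EuclideanSpace ℝ (Fin n), ∃ w, ∀ v, quad (P w)⁻¹ x ≤ quad (P v)⁻¹ x :=
    fun x => Finite.exists_min fun w => quad (P w)⁻¹ x
  choose s hs using hmin
  refine ⟨s, ?_⟩
  choose v hv using exists_edge (M := M) (T := T)
  have hdec : ∀ᶠ δ : ℝ in 𝓝[>] 0, ∀ (w : Node M T) (i : Fin M) (x : EuclideanSpace ℝ (Fin n)),
      δ * ‖x‖ ^ 2 ≤ quad ((P w)⁻¹ - (A i + B i * (K w i * (P w)⁻¹))ᵀ * (P (v w i))⁻¹ *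
        (A i + B i * (K w i * (P w)⁻¹))) x :=
    eventually_all.2 fun w => eventually_all.2 fun i =>
      eventually_le_quad (posDef_decrease_of_lmiBlock (hP _) (hP _) (hE _ _ _ (hv w i)))
  have hlow : ∀ᶠ δ : ℝ in 𝓝[>] 0, ∀ (w : Node M T) (x : EuclideanSpace ℝ (Fin n)),
      δ * ‖x‖ ^ 2 ≤ quad (P w)⁻¹ x :=
    eventually_all.2 fun w => eventually_le_quad (hP w).inv
  have hup : ∀ᶠ c : ℝ in atTop, ∀ (w : Node M T) (x : EuclideanSpace ℝ (Fin n)),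
      quad (P w)⁻¹ x ≤ c * ‖x‖ ^ 2 :=
    eventually_all.2 fun w => eventually_quad_le _
  obtain ⟨δ, ⟨hdec, hlow⟩, hδ⟩ := ((hdec.and hlow).and self_mem_nhdsWithin).exists
  -- `c ≥ δ` puts the contraction factor `1 - δ / c` in `[0, 1)`.
  obtain ⟨c, hup, hc⟩ := (hup.and (eventually_ge_atTop δ)).exists
  have hδ : 0 < δ := hδ
  have hc0 : 0 < c := hδ.trans_le hc
  have hr0 : 0 ≤ 1 - δ / c := sub_nonneg.2 ((div_le_one hc0).2 hc)
  have hr1 : 1 - δ / c < 1 := sub_lt_self _ (by positivity)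
  refine ⟨√(c / δ), √(1 - δ / c), by positivity, by positivity, ?_, ?_⟩
  · rw [Real.sqrt_lt' one_pos]; simpa using hr1
  intro x₀ φ hφ k
  set V : EuclideanSpace ℝ (Fin n) → ℝ := fun x => quad (P (s x))⁻¹ x with hV
  have hstep : ∀ k, V (φ (k + 1)) ≤ (1 - δ / c) * V (φ k) := by
    intro k
    obtain ⟨i, hi⟩ := hφ.2 k
    have h1 := hdec (s (φ k)) i (φ k)
    -- The new minimum is at most the form at the edge's target.
    have h2 := hs (φ (k + 1)) (v (s (φ k)) i)
    have h3 := hup (s (φ k)) (φ k)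
    set F := A i + B i * (K (s (φ k)) i * (P (s (φ k)))⁻¹) with hF
    have hy : (φ (k + 1)).ofLp = F *ᵥ (φ k).ofLp := by
      rw [hi, hF]
      simp [add_mulVec, mulVec_mulVec]
    have h4 : quad ((P (s (φ k)))⁻¹ - Fᵀ * (P (v (s (φ k)) i))⁻¹ * F) (φ k) =
        quad (P (s (φ k)))⁻¹ (φ k) - quad (P (v (s (φ k)) i))⁻¹ (φ (k + 1)) := by
      simp only [quad, hy, sub_mulVec, dotProduct_sub]
      rw [← mulVec_mulVec, ← mulVec_mulVec, dotProduct_mulVec _ Fᵀ, vecMul_transpose]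
    have h5 : δ / c * V (φ k) ≤ δ * ‖φ k‖ ^ 2 := by
      calc δ / c * V (φ k) ≤ δ / c * (c * ‖φ k‖ ^ 2) := by
            exact mul_le_mul_of_nonneg_left h3 (by positivity)
        _ = δ * ‖φ k‖ ^ 2 := by field_simp
    have h6 : V (φ (k + 1)) ≤ V (φ k) - δ * ‖φ k‖ ^ 2 := by
      simp only [hV]; linarith
    linarith
  have hiter : V (φ k) ≤ (1 - δ / c) ^ k * V x₀ := by
    induction k with
    | zero => simp [hφ.1]
    | succ k ih =>
      calc _ ≤ _ := hstep k
        _ ≤ (1 - δ / c) * ((1 - δ / c) ^ k * V x₀) := mul_le_mul_of_nonneg_left ih hr0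
        _ = _ := by ring
  have hfin : δ * ‖φ k‖ ^ 2 ≤ (1 - δ / c) ^ k * (c * ‖x₀‖ ^ 2) :=
    (hlow _ _).trans (hiter.trans (mul_le_mul_of_nonneg_left (hup _ _) (by positivity)))
  refine abs_le_of_sq_le_sq' ?_ (by positivity) |>.2
  rw [mul_pow, mul_pow, ← pow_mul, mul_comm k 2, pow_mul, Real.sq_sqrt hr0,
    Real.sq_sqrt (by positivity)]
  calc ‖φ k‖ ^ 2 = δ * ‖φ k‖ ^ 2 / δ := by field_simp
    _ ≤ (1 - δ / c) ^ k * (c * ‖x₀‖ ^ 2) / δ := by gcongr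
    _ = _ := by ring

end Sufficiency

/-! ### From a stabilizing feedback to LMIs -/

section Necessity

variable {M n m : ℕ} (A : Fin M → Matrix (Fin n) (Fin n) ℝ) (B : Fin M → Matrix (Fin n) (Fin m) ℝ)
  (Φ : Fin M → EuclideanSpace ℝ (Fin n) → EuclideanSpace ℝ (Fin m))

/-- The state reached from `x` by the closed loop along the string `w` of modes. -/
noncomputable def stateAlong (x : EuclideanSpace ℝ (Fin n)) (w : List (Fin M)) : EuclideanSpace ℝ (Fin n) :=
  w.foldl (fun y i => toEuclideanLin (A i) y + toEuclideanLin (B i) (Φ i y)) x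

theorem stateAlong_append_singleton (x : EuclideanSpace ℝ (Fin n)) (w : List (Fin M))
    (i : Fin M) : stateAlong A B Φ x (w ++ [i]) =
      toEuclideanLin (A i) (stateAlong A B Φ x w) +
        toEuclideanLin (B i) (Φ i (stateAlong A B Φ x w)) := by
  simp [stateAlong]

variable {A B Φ}

theorem norm_stateAlong_le {C γ : ℝ}
    (h : ∀ (x₀ : EuclideanSpace ℝ (Fin n)) (φ : ℕ → EuclideanSpace ℝ (Fin n)),
      IsSolution (closedLoopDep A B Φ) x₀ φ → ∀ k : ℕ, ‖φ k‖ ≤ C * γ ^ k * ‖x₀‖)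
    (x : EuclideanSpace ℝ (Fin n)) (w : List (Fin M)) (i : Fin M) :
    ‖stateAlong A B Φ x w‖ ≤ C * γ ^ w.length * ‖x‖ := by
  -- The default `i` extends `w` to an infinite switching signal, as a global solution requires.
  have hw : (List.range w.length).map (fun j => w.getD j i) = w := by
    apply List.ext_getElem <;> simp +contextual
  have := h x (fun k => stateAlong A B Φ x ((List.range k).map fun j => w.getD j i))
    ⟨rfl, fun k => ⟨w.getD k i, by
      simp only [List.range_succ, List.map_append, List.map_cons, List.map_nil,
        stateAlong_append_singleton]⟩⟩ w.length
  simpa only [hw] using this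

variable (A B Φ)

/-- The matrix whose columns are the states reached from the standard basis vectors. -/
noncomputable def stateMatrix (w : List (Fin M)) : Matrix (Fin n) (Fin n) ℝ :=
  Matrix.of fun a j => stateAlong A B Φ (EuclideanSpace.single j 1) w a

/-- The matrix whose columns are the feedback values at the columns of `X`. -/
def feedbackMatrix (Ψ : EuclideanSpace ℝ (Fin n) → EuclideanSpace ℝ (Fin m))
    (X : Matrix (Fin n) (Fin n) ℝ) : Matrix (Fin m) (Fin n) ℝ :=
  Matrix.of fun a j => Ψ (WithLp.toLp 2 (X.col j)) a

theorem stateMatrix_nil : stateMatrix A B Φ [] = 1 := by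
  ext a j
  simp [stateMatrix, stateAlong, Matrix.one_apply]

theorem stateMatrix_append_singleton (w : List (Fin M)) (i : Fin M) :
    stateMatrix A B Φ (w ++ [i]) = A i * stateMatrix A B Φ w +
      B i * feedbackMatrix (Φ i) (stateMatrix A B Φ w) := by
  ext a j
  simp only [stateMatrix, of_apply, stateAlong_append_singleton]
  rfl

variable {A B Φ}

theorem sum_sq_stateMatrix_le {C γ : ℝ}
    (h : ∀ (x₀ : EuclideanSpace ℝ (Fin n)) (φ : ℕ → EuclideanSpace ℝ (Fin n)),
      IsSolution (closedLoopDep A B Φ) x₀ φ → ∀ k : ℕ, ‖φ k‖ ≤ C * γ ^ k * ‖x₀‖)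
    (w : List (Fin M)) (i : Fin M) :
    ∑ j, ∑ a, stateMatrix A B Φ w a j ^ 2 ≤ n * (C * γ ^ w.length) ^ 2 := by
  calc _ ≤ ∑ _j : Fin n, (C * γ ^ w.length) ^ 2 := by
        refine Finset.sum_le_sum fun j _ => ?_
        have h1 := norm_stateAlong_le h (EuclideanSpace.single j 1) w i
        simp only [PiLp.norm_single, norm_one, mul_one] at h1
        have h2 := pow_le_pow_left₀ (norm_nonneg _) h1 2
        rwa [EuclideanSpace.real_norm_sq_eq] at h2
    _ = _ := by simp

/-- Exponential stability makes the matrix inequalities feasible on all sufficiently deep trees,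
with gains obtained from the feedback values along the trajectories of the basis vectors. -/
theorem exists_lmi_of_isUES (h : IsUES (closedLoopDep A B Φ)) :
    ∃ T₀ : ℕ, ∀ T, T₀ ≤ T → ∃ (P X : Node M T → Matrix (Fin n) (Fin n) ℝ),
      (∀ w, (P w).PosDef) ∧ ∀ w v i, Edge w v i →
        (lmiBlock (A i) (B i) (P w) (P v) (feedbackMatrix (Φ i) (X w) * (X w)ᵀ)).PosDef := by
  obtain ⟨C, γ, -, hγ0, hγ1, h⟩ := h
  -- A reset edge involves the state after `T + 1` modes.
  have hlim : Tendsto (fun T : ℕ => (n : ℝ) * (C * γ ^ (T + 1)) ^ 2) atTop (𝓝 0) := by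
    have h1 := (tendsto_pow_atTop_nhds_zero_of_lt_one hγ0 hγ1).comp (tendsto_add_atTop_nat 1)
    simpa using ((h1.const_mul C).pow 2).const_mul (n : ℝ)
  obtain ⟨T₀, hT₀⟩ := eventually_atTop.1 (hlim.eventually_lt_const (half_pos one_pos))
  refine ⟨T₀, fun T hT => ?_⟩
  set a : ℝ := 1 + ∑ i, ∑ k, ∑ l, A i l k ^ 2 with ha
  have ha1 : 1 ≤ a := le_add_of_nonneg_right (by positivity)
  have hA : ∀ i, (a • (1 : Matrix (Fin n) (Fin n) ℝ) - A i * (A i)ᵀ).PosDef := fun i => by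
    refine posDef_smul_one_sub_mul_transpose _ ?_
    have := Finset.single_le_sum (f := fun i => ∑ k, ∑ l, A i l k ^ 2)
      (fun i _ => by positivity) (Finset.mem_univ i)
    simp only [ha]
    linarith
  -- Chosen so that `ε * a ^ (T + 1) = 1 / 2`, half the identity available at the root.
  set ε : ℝ := 1 / (2 * a ^ (T + 1)) with hε
  have hε0 : 0 < ε := by positivity
  set X : List (Fin M) → Matrix (Fin n) (Fin n) ℝ := stateMatrix A B Φ with hX
  set P : Node M T → Matrix (Fin n) (Fin n) ℝ :=
    fun w => X w.1 * (X w.1)ᵀ + (ε * a ^ w.1.length) • 1 with hPdef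
  have hPt : ∀ w, (P w)ᵀ = P w := fun w => by simp [hPdef]
  refine ⟨P, fun w => X w.1, fun w => ?_, fun w v i hwv => ?_⟩
  · have h1 : (X w.1 * (X w.1)ᵀ).PosSemidef := by
      simpa using posSemidef_self_mul_conjTranspose (X w.1)
    exact .posSemidef_add h1 (PosDef.one.smul (by positivity))
  · refine posDef_lmiBlock_of_data _ _ _ _ _ (by positivity) (hPt v) ?_
    rw [← stateMatrix_append_singleton]
    cases hwv with
    | grow _ hlt =>
      have e : P (child w i hlt) - stateMatrix A B Φ (w.1 ++ [i]) *
          (stateMatrix A B Φ (w.1 ++ [i]))ᵀ - (ε * a ^ w.1.length) • (A i * (A i)ᵀ) =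
          (ε * a ^ w.1.length) • (a • 1 - A i * (A i)ᵀ) := by
        simp only [hPdef, hX, child, List.length_append, List.length_singleton, smul_sub,
          smul_smul, pow_succ, mul_assoc]
        abel
      rw [e]
      exact (hA i).smul (by positivity)
    | reset _ heq =>
      have hY := posDef_smul_one_sub_mul_transpose (X (w.1 ++ [i])) (c := 1 / 2)
        ((sum_sq_stateMatrix_le h _ i).trans_lt (by simpa [heq] using hT₀ T hT))
      have hεT : ε * a ^ T * a = 1 / 2 := by rw [hε, pow_succ]; field_simp
      -- One half of the identity absorbs the final states, the other the `A i * (A i)ᵀ` term.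
      have e : P (root M T) - X (w.1 ++ [i]) * (X (w.1 ++ [i]))ᵀ -
          (ε * a ^ w.1.length) • (A i * (A i)ᵀ) =
          ((1 / 2 : ℝ) • 1 - X (w.1 ++ [i]) * (X (w.1 ++ [i]))ᵀ) +
          ((ε * a ^ T) • (a • 1 - A i * (A i)ᵀ) + ε • 1) := by
        have h1 : (1 : Matrix (Fin n) (Fin n) ℝ) = (1 / 2 : ℝ) • 1 + (1 / 2 : ℝ) • 1 := by
          rw [← add_smul]; norm_num
        have h2 : X [] = 1 := stateMatrix_nil A B Φ
        simp only [hPdef, root, h2, List.length_nil, pow_zero, mul_one, transpose_one,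
          smul_sub, smul_smul, heq, hεT]
        nth_rewrite 1 [h1]
        abel
      rw [e]
      exact hY.add (((hA i).smul (by positivity)).add (PosDef.one.smul hε0))

end Necessity

/-! ### The two equivalences -/

section Equivalence

variable {M n m : ℕ} {A : Fin M → Matrix (Fin n) (Fin n) ℝ} {B : Fin M → Matrix (Fin n) (Fin m) ℝ}

/-- The selected node depends on the state alone, so gains constant in the mode give a
mode-independent feedback. -/
theorem FeasibleInd.isIFS {T : ℕ} (h : FeasibleInd A B T) : IsIFS A B := by
  obtain ⟨P, K, hP, hE⟩ := h
  obtain ⟨s, hs⟩ := exists_isUES_of_lmi (K := fun w _ => K w) hP hE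
  exact ⟨_, hs⟩

theorem FeasibleDep.isDFS {T : ℕ} (h : FeasibleDep A B T) : IsDFS A B := by
  obtain ⟨P, K, hP, hE⟩ := h
  obtain ⟨s, hs⟩ := exists_isUES_of_lmi hP hE
  exact ⟨_, hs⟩

theorem IsIFS.exists_feasibleInd (h : IsIFS A B) : ∃ T₀ : ℕ, ∀ T, T₀ ≤ T → FeasibleInd A B T := by
  obtain ⟨Φ, hΦ⟩ := h
  obtain ⟨T₀, hT₀⟩ := exists_lmi_of_isUES (A := A) (B := B) (Φ := fun _ => Φ) hΦ
  refine ⟨T₀, fun T hT => ?_⟩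
  obtain ⟨P, X, hP, hE⟩ := hT₀ T hT
  exact ⟨P, fun w => feedbackMatrix Φ (X w) * (X w)ᵀ, hP, hE⟩

theorem IsDFS.exists_feasibleDep (h : IsDFS A B) : ∃ T₀ : ℕ, ∀ T, T₀ ≤ T → FeasibleDep A B T := by
  obtain ⟨Φ, hΦ⟩ := h
  obtain ⟨T₀, hT₀⟩ := exists_lmi_of_isUES hΦ
  refine ⟨T₀, fun T hT => ?_⟩
  obtain ⟨P, X, hP, hE⟩ := hT₀ T hT
  exact ⟨P, fun w i => feedbackMatrix (Φ i) (X w) * (X w)ᵀ, hP, hE⟩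

end Equivalence

end FeedbackTree

theorem mainTheorem2 {M n m : ℕ} (A : Fin M → Matrix (Fin n) (Fin n) ℝ)
    (B : Fin M → Matrix (Fin n) (Fin m) ℝ) :
    ((FeedbackTree.IsIFS A B ↔ ∃ T : ℕ, FeedbackTree.FeasibleInd A B T) ∧
      (FeedbackTree.IsIFS A B ↔ ∃ T₀ : ℕ, ∀ T : ℕ, T₀ ≤ T → FeedbackTree.FeasibleInd A B T)) ∧
    ((FeedbackTree.IsDFS A B ↔ ∃ T : ℕ, FeedbackTree.FeasibleDep A B T) ∧
      (FeedbackTree.IsDFS A B ↔ ∃ T₀ : ℕ, ∀ T : ℕ, T₀ ≤ T → FeedbackTree.FeasibleDep A B T)) :=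
  ⟨⟨⟨fun h => h.exists_feasibleInd.imp fun _ h => h _ le_rfl, fun ⟨_, h⟩ => h.isIFS⟩,
    ⟨fun h => h.exists_feasibleInd, fun ⟨_, h⟩ => (h _ le_rfl).isIFS⟩⟩,
   ⟨⟨fun h => h.exists_feasibleDep.imp fun _ h => h _ le_rfl, fun ⟨_, h⟩ => h.isDFS⟩,
    ⟨fun h => h.exists_feasibleDep, fun ⟨_, h⟩ => (h _ le_rfl).isDFS⟩⟩⟩
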